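/- Let $M$ be a smooth ($C^\infty$, finite-dimensional, Hausdorff) manifold without boundary and let $p$ be a smooth bivector field on $M$, i.e. a smooth assignment $x\mapsto p(x)\in\wedge^2T_xM$ (not necessarily Poisson). For a covector $\alpha\in T_x^*M$ let $\tilde p(\alpha)\in T_xM$ be the vector determined by $\beta(\tilde p(\alpha))=(\alpha\wedge\beta)(p(x))$ for all $\beta\in T_x^*M$, put $\pi(x)=\{\tilde p(\alpha):\alpha\in T_x^*M\}\subset T_xM$, and put $\{f,g\}=(df\wedge dg)(p)$ for $f,g\in C^\infty(M)$. The differential system (possibly singular distribution) $\pi$ is called involutive if for any two vector fields $X=\sum_i\varphi_i\,\tilde p(df_i)$ and $Y=\sum_j\psi_j\,\tilde p(dg_j)$ (finite sums, $\varphi_i,f_i,\psi_j,g_j\in C^\infty(M)$) one has $[X,Y](x)\in\pi(x)$ for every $x\in M$. Let $[p,p]$ be the Schouten bracket of $p$ with itself, i.e. the field of trivectors with $$(df\wedge dg\wedge dh)([p,p])=2\big(\{\{f,g\},h\}+\{\{g,h\},f\}+\{\{h,f\},g\}\big)\qquad\text{for all } f,g,h\in C^\infty(M).$$ Then $\pi$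 is involutive if and only if $$[p,p](x)\in\pi(x)\wedge\pi(x)\wedge\pi(x)\subset\wedge^3T_xM\qquad\text{for every } x\in M.$$ -/

import Mathlib

open scoped Manifold ContDiff

namespace Multivector

section LinearAlgebra
variable {V : Type*} [AddCommGroup V] [Module ℝ V]

/-- The value `(α₁ ∧ ⋯ ∧ αₖ)(T)` of a product of covectors on a `k`-vector, normalised by
`(α₁ ∧ ⋯ ∧ αₖ)(v₁ ∧ ⋯ ∧ vₖ) = det (αⱼ vᵢ)`. -/
noncomputable def wedgeEval {k : ℕ} (α : Fin k → Module.Dual ℝ V) (T : ⋀[ℝ]^k V) : ℝ :=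
  exteriorPower.pairingDual ℝ V k (exteriorPower.ιMulti ℝ k α) T

theorem update_pair_zero {X : Type*} (a b c : X) :
    Function.update ![a, c] 0 b = ![b, c] := by
  ext i; fin_cases i <;> rfl

theorem update_pair_one {X : Type*} (a b c : X) :
    Function.update ![a, c] 1 b = ![a, b] := by
  ext i; fin_cases i <;> rfl

/-- A bivector as a bilinear form on covectors, `(α, β) ↦ (α ∧ β)(P)`. -/
noncomputable def bivectorForm (P : ⋀[ℝ]^2 V) :
    Module.Dual ℝ V →ₗ[ℝ] Module.Dual ℝ V →ₗ[ℝ] ℝ :=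
  LinearMap.mk₂ ℝ (fun α β => wedgeEval ![α, β] P)
    (fun a b c => by
      have := (exteriorPower.ιMulti ℝ 2).map_update_add ![a, c] 0 a b
      simp only [update_pair_zero] at this
      simp only [wedgeEval, this, map_add, LinearMap.add_apply])
    (fun r a c => by
      have := (exteriorPower.ιMulti ℝ 2).map_update_smul ![a, c] 0 r a
      simp only [update_pair_zero] at this
      simp only [wedgeEval, this, map_smul, LinearMap.smul_apply])
    (fun a b c => by
      have := (exteriorPower.ιMulti ℝ 2).map_update_add ![a, c] 1 b c
      simp only [update_pair_one] at this
      simp only [wedgeEval, this, map_add, LinearMap.add_apply])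
    (fun r a c => by
      have := (exteriorPower.ιMulti ℝ 2).map_update_smul ![a, c] 1 r c
      simp only [update_pair_one] at this
      simp only [wedgeEval, this, map_smul, LinearMap.smul_apply])

theorem bivectorForm_apply (P : ⋀[ℝ]^2 V) (α β : Module.Dual ℝ V) :
    bivectorForm P α β = wedgeEval ![α, β] P := rfl

theorem bivectorForm_self (P : ⋀[ℝ]^2 V) (α : Module.Dual ℝ V) : bivectorForm P α α = 0 := by
  rw [bivectorForm_apply, wedgeEval, (exteriorPower.ιMulti ℝ 2).map_eq_zero_of_eq ![α, α]
    (i := 0) (j := 1) rfl (by decide)]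
  simp

theorem bivectorForm_swap (P : ⋀[ℝ]^2 V) (α β : Module.Dual ℝ V) :
    bivectorForm P α β = - bivectorForm P β α := by
  have h := bivectorForm_self P (α + β)
  simp only [map_add, LinearMap.add_apply, bivectorForm_self] at h
  linarith

/-- The contraction `α ↦ P̃(α)`, characterised by `β (P̃ α) = (α ∧ β)(P)`. -/
noncomputable def bivectorSharp [FiniteDimensional ℝ V] (P : ⋀[ℝ]^2 V) :
    Module.Dual ℝ V →ₗ[ℝ] V :=
  (Module.evalEquiv ℝ V).symm.toLinearMap ∘ₗ bivectorForm P

theorem apply_bivectorSharp [FiniteDimensional ℝ V] (P : ⋀[ℝ]^2 V) (α β : Module.Dual ℝ V) :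
    β (bivectorSharp P α) = wedgeEval ![α, β] P := by
  simp [bivectorSharp, bivectorForm_apply]

/-- `W ∧ ⋯ ∧ W` (`k` factors) as a subspace of the `k`-th exterior power of `V`. -/
noncomputable def wedgePower (k : ℕ) (W : Submodule ℝ V) : Submodule ℝ (⋀[ℝ]^k V) :=
  LinearMap.range (exteriorPower.map k W.subtype)

/-- Covectors separate `k`-vectors, and every alternating form on covectors is a `k`-vector. -/
theorem existsUnique_wedgeEval_eq [FiniteDimensional ℝ V] {k : ℕ}
    (G : (Module.Dual ℝ V) [⋀^Fin k]→ₗ[ℝ] ℝ) :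
    ∃! T : ⋀[ℝ]^k V, ∀ α, wedgeEval α T = G α := by
  set Ψ : ⋀[ℝ]^k V →ₗ[ℝ] Module.Dual ℝ (⋀[ℝ]^k (Module.Dual ℝ V)) :=
    (exteriorPower.pairingDual ℝ V k).flip with hΨ
  have hval : ∀ α T, Ψ T (exteriorPower.ιMulti ℝ k α) = wedgeEval α T := fun α T => rfl
  have hinj : Function.Injective Ψ := by
    rw [injective_iff_map_eq_zero]
    intro T hT
    let b := Module.finBasis ℝ V
    apply (b.exteriorPower (n := k)).ext_elem
    intro s
    rw [exteriorPower.basis_repr_apply]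
    have := hval (fun j => b.coord (Set.powersetCard.ofFinEmbEquiv.symm s j)) T
    rw [hT] at this
    simp only [map_zero, Finsupp.coe_zero, Pi.zero_apply]
    exact this.symm
  have hsurj : Function.Surjective Ψ := by
    refine (LinearMap.injective_iff_surjective_of_finrank_eq_finrank ?_).1 hinj
    rw [Subspace.dual_finrank_eq, exteriorPower.finrank_eq, exteriorPower.finrank_eq,
      Subspace.dual_finrank_eq]
  obtain ⟨T, hT⟩ := hsurj (exteriorPower.alternatingMapLinearEquiv G)
  refine ⟨T, fun α => ?_, fun T' hT' => ?_⟩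
  · rw [← hval, hT]; simp
  · apply hinj
    rw [hT]
    apply exteriorPower.linearMap_ext
    ext α
    simpa [hval] using hT' α

end LinearAlgebra
end Multivector

section Manifold
variable {n : ℕ} {M : Type*} [TopologicalSpace M] [ChartedSpace (EuclideanSpace ℝ (Fin n)) M]

/-- The differential `df(x)` as a linear form on the tangent space. -/
noncomputable def differentialAt (f : C^∞⟮𝓡 n, M; ℝ⟯) (x : M) :
    Module.Dual ℝ (TangentSpace (𝓡 n) x) :=
  (mvfderiv (𝓡 n) f x).toLinearMap

instance finiteDimensional_tangentSpace (x : M) : FiniteDimensional ℝ (TangentSpace (𝓡 n) x) :=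
  inferInstanceAs (FiniteDimensional ℝ (EuclideanSpace ℝ (Fin n)))

variable (n M) in
/-- A smooth bivector field: an element of the second exterior power of each tangent space,
depending smoothly on the point, i.e. `(df ∧ dg)(p)` is a smooth function for all smooth functions
`f` and `g` (equivalently, the components of `p` in local coordinates are smooth). -/
structure BivectorField where
  toFun : ∀ x : M, ⋀[ℝ]^2 (TangentSpace (𝓡 n) x)
  contMDiff_wedgeEval : ∀ f g : C^∞⟮𝓡 n, M; ℝ⟯,
    ContMDiff (𝓡 n) 𝓘(ℝ, ℝ) ∞
      fun x => Multivector.wedgeEval ![differentialAt f x, differentialAt g x] (toFun x)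

namespace BivectorField

/-- `{f, g} = (df ∧ dg)(p)`. -/
noncomputable def bracket (p : BivectorField n M) (f g : C^∞⟮𝓡 n, M; ℝ⟯) : C^∞⟮𝓡 n, M; ℝ⟯ :=
  ⟨_, p.contMDiff_wedgeEval f g⟩

/-- The vector field `p̃(df) = {f, ·}`. -/
noncomputable def hamiltonianField (p : BivectorField n M) (f : C^∞⟮𝓡 n, M; ℝ⟯) (x : M) :
    TangentSpace (𝓡 n) x :=
  Multivector.bivectorSharp (p.toFun x) (differentialAt f x)

/-- The possibly singular distribution `π`: `π(x)` is the set of the vectors `p̃(α)` for `α` in the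
cotangent space at `x`. -/
noncomputable def differentialSystem (p : BivectorField n M) (x : M) :
    Submodule ℝ (TangentSpace (𝓡 n) x) :=
  LinearMap.range (Multivector.bivectorSharp (p.toFun x))

/-- The vector fields spanned by the `p̃(df)` over the algebra of smooth functions: the finite sums
`∑ φᵢ p̃(dfᵢ)`. -/
def spannedFields (p : BivectorField n M) : Set (∀ x : M, TangentSpace (𝓡 n) x) :=
  {X | ∃ (k : ℕ) (φ f : Fin k → C^∞⟮𝓡 n, M; ℝ⟯),
    X = fun x => ∑ i, φ i x • p.hamiltonianField (f i) x}

/-- `π` is involutive: the commutator of any two of the vector fields that span `π` takes its values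
in `π`. -/
def IsInvolutive (p : BivectorField n M) : Prop :=
  ∀ X ∈ p.spannedFields, ∀ Y ∈ p.spannedFields, ∀ x : M,
    VectorField.mlieBracket (𝓡 n) X Y x ∈ p.differentialSystem x

/-- The compositional product `p ∘ q` of two skew biderivations of the algebra of functions: the
sum over all permutations `s` of three letters with `s 1 < s 2` of
`sgn s • p (q (f (s 1), f (s 2)), f (s 3))`. -/
noncomputable def compProd (p q : BivectorField n M) (f g h : C^∞⟮𝓡 n, M; ℝ⟯) :
    C^∞⟮𝓡 n, M; ℝ⟯ :=
  p.bracket (q.bracket f g) h - p.bracket (q.bracket f h) g + p.bracket (q.bracket g h) f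

/-- The supercommutator `[p, q] = (-1)^((2 + 1) * 2) p ∘ q + (-1)^2 q ∘ p = p ∘ q + q ∘ p`, as a skew
triderivation of the algebra of functions. -/
noncomputable def schoutenDerivation (p q : BivectorField n M) (f g h : C^∞⟮𝓡 n, M; ℝ⟯) :
    C^∞⟮𝓡 n, M; ℝ⟯ :=
  compProd p q f g h + compProd q p f g h

theorem bracket_apply (p : BivectorField n M) (f g : C^∞⟮𝓡 n, M; ℝ⟯) (x : M) :
    p.bracket f g x =
      Multivector.bivectorForm (p.toFun x) (differentialAt f x) (differentialAt g x) := rfl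

theorem differentialAt_hamiltonianField (p : BivectorField n M) (f g : C^∞⟮𝓡 n, M; ℝ⟯) (x : M) :
    differentialAt g x (p.hamiltonianField f x) = p.bracket f g x :=
  Multivector.apply_bivectorSharp _ _ _

theorem bracket_swap (p : BivectorField n M) (f g : C^∞⟮𝓡 n, M; ℝ⟯) :
    p.bracket f g = - p.bracket g f := by
  ext x
  exact Multivector.bivectorForm_swap _ _ _

theorem bracket_self (p : BivectorField n M) (f : C^∞⟮𝓡 n, M; ℝ⟯) : p.bracket f f = 0 := by
  ext x
  exact Multivector.bivectorForm_self _ _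

theorem mdifferentiableAt_coe (f : C^∞⟮𝓡 n, M; ℝ⟯) (x : M) :
    MDifferentiableAt (𝓡 n) 𝓘(ℝ, ℝ) f x :=
  (f.contMDiff x).mdifferentiableAt (by simp)

theorem differentialAt_add (f g : C^∞⟮𝓡 n, M; ℝ⟯) (x : M) :
    differentialAt (f + g) x = differentialAt f x + differentialAt g x := by
  have := mvfderiv_add (mdifferentiableAt_coe f x) (mdifferentiableAt_coe g x)
  rw [differentialAt, ContMDiffMap.coe_add, this]; rfl

theorem differentialAt_smul (r : ℝ) (f : C^∞⟮𝓡 n, M; ℝ⟯) (x : M) :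
    differentialAt (r • f) x = r • differentialAt f x := by
  have := mvfderiv_smul (mdifferentiableAt_const (I := 𝓡 n) (c := r) (x := x))
    (mdifferentiableAt_coe f x)
  have h2 : ⇑(r • f) = (fun _ : M => r) • ⇑f := rfl
  rw [differentialAt, h2, this]
  ext v
  have h3 : mvfderiv (𝓡 n) (fun _ : M => r) x = 0 := mvfderiv_const r
  simp [differentialAt, h3]

theorem bracket_add_left (p : BivectorField n M) (f g h : C^∞⟮𝓡 n, M; ℝ⟯) :
    p.bracket (f + g) h = p.bracket f h + p.bracket g h := by
  ext x; simp [bracket_apply, differentialAt_add]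

theorem bracket_smul_left (p : BivectorField n M) (r : ℝ) (f h : C^∞⟮𝓡 n, M; ℝ⟯) :
    p.bracket (r • f) h = r • p.bracket f h := by
  ext x; simp [bracket_apply, differentialAt_smul]

theorem bracket_add_right (p : BivectorField n M) (f g h : C^∞⟮𝓡 n, M; ℝ⟯) :
    p.bracket f (g + h) = p.bracket f g + p.bracket f h := by
  ext x; simp [bracket_apply, differentialAt_add]

theorem bracket_smul_right (p : BivectorField n M) (r : ℝ) (f h : C^∞⟮𝓡 n, M; ℝ⟯) :
    p.bracket f (r • h) = r • p.bracket f h := by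
  ext x; simp [bracket_apply, differentialAt_smul]

theorem schoutenDerivation_swap_left (p q : BivectorField n M) (f g h : C^∞⟮𝓡 n, M; ℝ⟯) :
    schoutenDerivation p q f g h = - schoutenDerivation p q g f h := by
  have hneg : ∀ (r : BivectorField n M) (u v : C^∞⟮𝓡 n, M; ℝ⟯),
      r.bracket (-u) v = - r.bracket u v := fun r u v => by
    rw [← neg_one_smul ℝ u, bracket_smul_left, neg_one_smul]
  simp only [schoutenDerivation, compProd]
  rw [bracket_swap q f g, bracket_swap p f g, hneg, hneg]
  abel

theorem schoutenDerivation_swap_right (p q : BivectorField n M) (f g h : C^∞⟮𝓡 n, M; ℝ⟯) :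
    schoutenDerivation p q f g h = - schoutenDerivation p q f h g := by
  have hneg : ∀ (r : BivectorField n M) (u v : C^∞⟮𝓡 n, M; ℝ⟯),
      r.bracket (-u) v = - r.bracket u v := fun r u v => by
    rw [← neg_one_smul ℝ u, bracket_smul_left, neg_one_smul]
  simp only [schoutenDerivation, compProd]
  rw [bracket_swap q g h, bracket_swap p g h, hneg, hneg]
  abel

theorem mvfderiv_eq_of_hasMFDerivAt {u : M → ℝ} {x : M} {L : TangentSpace (𝓡 n) x →L[ℝ] ℝ}
    (h : HasMFDerivAt (𝓡 n) 𝓘(ℝ, ℝ) u x L) (v : TangentSpace (𝓡 n) x) :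
    mvfderiv (𝓡 n) u x v = L v := by
  rw [mvfderiv, h.mfderiv]; rfl

/-- The chain rule for a function on the model space composed with a map to it. -/
theorem hasMFDerivAt_fderiv_comp {Φ : M → EuclideanSpace ℝ (Fin n)} {x : M}
    (hΦ : MDifferentiableAt (𝓡 n) (𝓡 n) Φ x) {F : EuclideanSpace ℝ (Fin n) → ℝ}
    {L : EuclideanSpace ℝ (Fin n) →L[ℝ] ℝ} (hF : HasFDerivAt F L (Φ x)) :
    HasMFDerivAt (𝓡 n) 𝓘(ℝ, ℝ) (F ∘ Φ) x (L.comp (mfderiv (𝓡 n) (𝓡 n) Φ x)) :=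
  hF.hasMFDerivAt.comp x hΦ.hasMFDerivAt

variable [IsManifold (𝓡 n) ∞ M] [T2Space M]

/-- There is a smooth map to the model space which agrees with a given chart near its centre. -/
theorem exists_globalChart (x : M) : ∃ Φ : M → EuclideanSpace ℝ (Fin n),
    ContMDiff (𝓡 n) (𝓡 n) ∞ Φ ∧ Φ =ᶠ[nhds x] extChartAt (𝓡 n) x := by
  let χ : SmoothBumpFunction (𝓡 n) x := Classical.arbitrary _
  refine ⟨fun y => χ y • extChartAt (𝓡 n) x y, χ.contMDiff_smul ?_, ?_⟩
  · simpa using contMDiffOn_extChartAt (I := 𝓡 n) (n := ∞) (x := x)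
  · filter_upwards [χ.eventuallyEq_one] with y hy
    simp [hy]

theorem differentialAt_surjective (x : M) :
    Function.Surjective fun f : C^∞⟮𝓡 n, M; ℝ⟯ => differentialAt f x := by
  intro α
  obtain ⟨Φ, hΦ, hΦx⟩ := exists_globalChart (n := n) x
  have hinv := isInvertible_mfderiv_extChartAt (I := 𝓡 n) (mem_extChartAt_source (I := 𝓡 n) x)
  obtain ⟨e, he⟩ := hinv
  let α' : EuclideanSpace ℝ (Fin n) →L[ℝ] ℝ := LinearMap.toContinuousLinearMap
    (show EuclideanSpace ℝ (Fin n) →ₗ[ℝ] ℝ from α ∘ₗ e.symm.toLinearMap)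
  refine ⟨⟨fun y => α' (Φ y), α'.contMDiff.comp hΦ⟩, ?_⟩
  ext v
  change mvfderiv (𝓡 n) (α' ∘ Φ) x v = α v
  rw [mvfderiv_eq_of_hasMFDerivAt (hasMFDerivAt_fderiv_comp ((hΦ x).mdifferentiableAt (by simp))
    α'.hasFDerivAt), hΦx.mfderiv_eq, ← he]
  change α (e.symm (e v)) = α v
  rw [e.symm_apply_apply]

/-- Second derivatives commute at a critical point. -/
theorem differentialAt_comm_of_eq_zero (p q : BivectorField n M) (f g h : C^∞⟮𝓡 n, M; ℝ⟯) (x : M)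
    (hf : differentialAt f x = 0) :
    p.bracket g (q.bracket h f) x = q.bracket h (p.bracket g f) x := by
  obtain ⟨Φ, hΦ, hΦx⟩ := exists_globalChart (n := n) x
  have hΦd : ∀ y, MDifferentiableAt (𝓡 n) (𝓡 n) Φ y := fun y => (hΦ y).mdifferentiableAt (by simp)
  let F : EuclideanSpace ℝ (Fin n) → ℝ := f ∘ (extChartAt (𝓡 n) x).symm
  have hF : ContDiffOn ℝ ∞ F (extChartAt (𝓡 n) x).target := by
    rw [← contMDiffOn_iff_contDiffOn]
    exact f.contMDiff.comp_contMDiffOn (contMDiffOn_extChartAt_symm x)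
  have hopen : IsOpen (extChartAt (𝓡 n) x).target := isOpen_extChartAt_target x
  have hxs : extChartAt (𝓡 n) x x ∈ (extChartAt (𝓡 n) x).target := mem_extChartAt_target x
  have hΦxx : Φ x = extChartAt (𝓡 n) x x := hΦx.eq_of_nhds
  -- the differential of `f` near `x`
  have hdf : ∀ᶠ y in nhds x, Φ y ∈ (extChartAt (𝓡 n) x).target ∧ ∀ v,
      differentialAt f y v = fderiv ℝ F (Φ y) (mfderiv (𝓡 n) (𝓡 n) Φ y v) := by
    have hsrc : (extChartAt (𝓡 n) x).source ∈ nhds x := extChartAt_source_mem_nhds x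
    filter_upwards [hΦx.eventuallyEq_nhds, eventually_mem_nhds_iff.2 hsrc] with y hy hys
    have hyt : Φ y ∈ (extChartAt (𝓡 n) x).target := by
      rw [hy.eq_of_nhds]; exact (extChartAt (𝓡 n) x).map_source (mem_of_mem_nhds hys)
    refine ⟨hyt, fun v => ?_⟩
    have hfF : ⇑f =ᶠ[nhds y] F ∘ Φ := by
      filter_upwards [hy, hys] with z hz hzs
      change f z = f ((extChartAt (𝓡 n) x).symm (Φ z))
      rw [hz, (extChartAt (𝓡 n) x).left_inv hzs]
    have hFd : DifferentiableAt ℝ F (Φ y) :=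
      (hF.contDiffAt (hopen.mem_nhds hyt)).differentiableAt (by simp)
    exact mvfderiv_eq_of_hasMFDerivAt
      ((hasMFDerivAt_fderiv_comp (hΦd y) hFd.hasFDerivAt).congr_of_eventuallyEq hfF) v
  -- coordinates
  let Φc : Fin n → C^∞⟮𝓡 n, M; ℝ⟯ := fun i => ⟨fun y => Φ y i, by
    exact (EuclideanSpace.proj (𝕜 := ℝ) i).contMDiff.comp hΦ⟩
  have hΦc : ∀ i y (v : TangentSpace (𝓡 n) y), differentialAt (Φc i) y v =
      EuclideanSpace.proj (𝕜 := ℝ) i (mfderiv (𝓡 n) (𝓡 n) Φ y v) := fun i y v =>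
    mvfderiv_eq_of_hasMFDerivAt
      (hasMFDerivAt_fderiv_comp (hΦd y) (EuclideanSpace.proj (𝕜 := ℝ) i).hasFDerivAt) v
  have hD0 : fderiv ℝ F (Φ x) = 0 := by
    obtain ⟨e, he⟩ :=
      isInvertible_mfderiv_extChartAt (I := 𝓡 n) (mem_extChartAt_source (I := 𝓡 n) x)
    ext z
    have h1 := (hdf.self_of_nhds).2 (e.symm z)
    rw [hf, hΦx.mfderiv_eq, ← he] at h1
    exact (congrArg (fderiv ℝ F (Φ x)) (e.apply_symm_apply z)).symm.trans h1.symm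
  have hD2 : DifferentiableAt ℝ (fderiv ℝ F) (Φ x) := by
    have := (hF.contDiffAt (hopen.mem_nhds (hΦxx ▸ hxs)))
    exact (this.fderiv_right (m := 1) (by norm_cast)).differentiableAt (by simp)
  let w : BivectorField n M → C^∞⟮𝓡 n, M; ℝ⟯ → EuclideanSpace ℝ (Fin n) := fun r u =>
    mfderiv (𝓡 n) (𝓡 n) Φ x (r.hamiltonianField u x)
  have key : ∀ (r s : BivectorField n M) (u v : C^∞⟮𝓡 n, M; ℝ⟯),
      s.bracket v (r.bracket u f) x = fderiv ℝ (fderiv ℝ F) (Φ x) (w s v) (w r u) := by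
    intro r s u v
    let b := EuclideanSpace.basisFun (Fin n) ℝ
    have hsum : ∀ z : EuclideanSpace ℝ (Fin n), z = ∑ i, z i • b i := fun z => by
      simpa [b] using (b.sum_repr z).symm
    have hloc : ⇑(r.bracket u f) =ᶠ[nhds x]
        fun y => ∑ i, fderiv ℝ F (Φ y) (b i) * r.bracket u (Φc i) y := by
      filter_upwards [hdf] with y hy
      rw [← differentialAt_hamiltonianField, hy.2]
      conv_lhs => rw [hsum (mfderiv (𝓡 n) (𝓡 n) Φ y (r.hamiltonianField u y)), map_sum]
      refine Finset.sum_congr rfl fun i _ => ?_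
      rw [map_smul, ← differentialAt_hamiltonianField, hΦc, smul_eq_mul, mul_comm]
      rfl
    have hder : ∀ i, HasMFDerivAt (𝓡 n) 𝓘(ℝ, ℝ)
        (fun y => fderiv ℝ F (Φ y) (b i) * r.bracket u (Φc i) y) x
        ((r.bracket u (Φc i) x) • (((fderiv ℝ (fderiv ℝ F) (Φ x)).flip (b i)).comp
          (mfderiv (𝓡 n) (𝓡 n) Φ x))) := by
      intro i
      have h1 : HasFDerivAt (fun z => fderiv ℝ F z (b i))
          ((fderiv ℝ (fderiv ℝ F) (Φ x)).flip (b i)) (Φ x) := by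
        simpa using hD2.hasFDerivAt.clm_apply (hasFDerivAt_const (b i) (Φ x))
      have h2 := (hasMFDerivAt_fderiv_comp (hΦd x) h1).mul'
        (mdifferentiableAt_coe (r.bracket u (Φc i)) x).hasMFDerivAt
      have h3 : fderiv ℝ F (Φ x) (b i) = 0 := by rw [hD0]; rfl
      refine h2.congr_mfderiv ?_
      ext z
      change fderiv ℝ F (Φ x) (b i) * _ + _ * _ = _
      rw [h3, zero_mul, zero_add, mul_comm]
      rfl
    rw [← differentialAt_hamiltonianField]
    refine (mvfderiv_eq_of_hasMFDerivAt
      ((HasMFDerivAt.sum (t := Finset.univ) (fun i _ => hder i)).congr_of_eventuallyEq ?_) _).trans ?_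
    · filter_upwards [hloc] with y hy
      simp [hy]
    · rw [hsum (w r u), map_sum, _root_.sum_apply]
      refine Finset.sum_congr rfl fun i _ => ?_
      rw [map_smul, ← differentialAt_hamiltonianField, hΦc]
      rfl
  rw [key, key]
  have hsymm : IsSymmSndFDerivAt ℝ F (Φ x) :=
    (hF.contDiffAt (hopen.mem_nhds (hΦxx ▸ hxs))).isSymmSndFDerivAt
      (by simp only [minSmoothness_of_isRCLikeNormedField]; exact WithTop.coe_le_coe.2 (le_top : (2 : ℕ∞) ≤ ⊤))
  exact hsymm _ _

theorem schoutenDerivation_eq_zero (p q : BivectorField n M) (f g h : C^∞⟮𝓡 n, M; ℝ⟯) (x : M)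
    (hf : differentialAt f x = 0) : schoutenDerivation p q f g h x = 0 := by
  have h1 := differentialAt_comm_of_eq_zero p q f g h x hf
  have h2 := differentialAt_comm_of_eq_zero q p f g h x hf
  have e1 : ∀ (r : BivectorField n M) u, r.bracket u f x = 0 := fun r u => by
    simp [bracket_apply, hf]
  have e2 : ∀ (r s : BivectorField n M) (u v : C^∞⟮𝓡 n, M; ℝ⟯),
      r.bracket (s.bracket f u) v x = r.bracket v (s.bracket u f) x := fun r s u v => by
    have h3 : s.bracket f u = (-1 : ℝ) • s.bracket u f := by
      rw [bracket_swap s f u]; simp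
    rw [bracket_swap r, h3, bracket_smul_right]; simp
  simp only [schoutenDerivation, compProd, ContMDiffMap.coe_add, ContMDiffMap.coe_sub, Pi.add_apply,
    Pi.sub_apply, e1, e2]
  linarith

/-- A skew triderivation of the algebra of functions is a field of trivectors: there is exactly one
trivector at `x` whose value on `df ∧ dg ∧ dh` is `[p, q](f, g, h)(x)` for all `f`, `g`, `h`. -/
theorem existsUnique_schoutenBracket (p q : BivectorField n M) (x : M) :
    ∃! T : ⋀[ℝ]^3 (TangentSpace (𝓡 n) x), ∀ f g h : C^∞⟮𝓡 n, M; ℝ⟯,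
      Multivector.wedgeEval ![differentialAt f x, differentialAt g x, differentialAt h x] T =
        schoutenDerivation p q f g h x := by
  let S : C^∞⟮𝓡 n, M; ℝ⟯ → C^∞⟮𝓡 n, M; ℝ⟯ → C^∞⟮𝓡 n, M; ℝ⟯ → ℝ := fun f g h =>
    schoutenDerivation p q f g h x
  have hS1 : ∀ f g h, S f g h = - S g f h := fun f g h => by
    simp only [S]; rw [schoutenDerivation_swap_left]; rfl
  have hS2 : ∀ f g h, S f g h = - S f h g := fun f g h => by
    simp only [S]; rw [schoutenDerivation_swap_right]; rfl
  have hadd1 : ∀ f f' g h, S (f + f') g h = S f g h + S f' g h := fun f f' g h => by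
    simp only [S, schoutenDerivation, compProd, bracket_add_left, bracket_add_right,
      ContMDiffMap.coe_add, ContMDiffMap.coe_sub, Pi.add_apply, Pi.sub_apply]
    ring
  have hsmul1 : ∀ (r : ℝ) f g h, S (r • f) g h = r * S f g h := fun r f g h => by
    simp only [S, schoutenDerivation, compProd, bracket_smul_left, bracket_smul_right,
      ContMDiffMap.coe_add, ContMDiffMap.coe_sub, ContMDiffMap.coe_smul, Pi.add_apply,
      Pi.sub_apply, Pi.smul_apply, smul_eq_mul]
    ring
  have hadd2 : ∀ f g g' h, S f (g + g') h = S f g h + S f g' h := fun f g g' h => by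
    rw [hS1, hadd1, hS1 f g, hS1 f g']; ring
  have hsmul2 : ∀ (r : ℝ) f g h, S f (r • g) h = r * S f g h := fun r f g h => by
    rw [hS1, hsmul1, hS1 f g]; ring
  have hadd3 : ∀ f g h h', S f g (h + h') = S f g h + S f g h' := fun f g h h' => by
    rw [hS2, hadd2, hS2 f g h, hS2 f g h']; ring
  have hsmul3 : ∀ (r : ℝ) f g h, S f g (r • h) = r * S f g h := fun r f g h => by
    rw [hS2, hsmul2, hS2 f g h]; ring
  have halt1 : ∀ f h, S f f h = 0 := fun f h => by linarith [hS1 f f h]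
  have halt2 : ∀ f g, S f g g = 0 := fun f g => by linarith [hS2 f g g]
  have halt3 : ∀ f g, S f g f = 0 := fun f g => by rw [hS1, halt2, neg_zero]
  -- descent to differentials
  have hcongr1 : ∀ f f' g h, differentialAt f x = differentialAt f' x → S f g h = S f' g h := by
    intro f f' g h hff
    have h0 : S (f + (-1 : ℝ) • f') g h = 0 := by
      apply schoutenDerivation_eq_zero
      rw [differentialAt_add, differentialAt_smul, hff]
      ext v
      change differentialAt f' x v + (-1) * differentialAt f' x v = 0
      ring
    rw [hadd1, hsmul1] at h0
    linarith
  have hcongr : ∀ f f' g g' h h', differentialAt f x = differentialAt f' x →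
      differentialAt g x = differentialAt g' x → differentialAt h x = differentialAt h' x →
      S f g h = S f' g' h' := by
    intro f f' g g' h h' hf hg hh
    rw [hcongr1 f f' g h hf, hS1, hcongr1 g g' f' h hg, ← hS1, hS2, hS1, hcongr1 h h' f' g' hh,
      ← hS1, ← hS2]
  let D : C^∞⟮𝓡 n, M; ℝ⟯ →ₗ[ℝ] Module.Dual ℝ (TangentSpace (𝓡 n) x) :=
    { toFun := fun f => differentialAt f x
      map_add' := fun f g => differentialAt_add f g x
      map_smul' := fun r f => differentialAt_smul r f x }
  obtain ⟨s, hs⟩ := D.exists_rightInverse_of_surjective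
    (LinearMap.range_eq_top.2 (differentialAt_surjective x))
  have hsD : ∀ α, differentialAt (s α) x = α := fun α => LinearMap.congr_fun hs α
  let G : (Module.Dual ℝ (TangentSpace (𝓡 n) x)) [⋀^Fin 3]→ₗ[ℝ] ℝ :=
    { toFun := fun α => S (s (α 0)) (s (α 1)) (s (α 2))
      map_update_add' := by
        intro inst m i a b
        obtain rfl : inst = instDecidableEqFin 3 := Subsingleton.elim _ _
        fin_cases i <;> simp [hadd1, hadd2, hadd3]
      map_update_smul' := by
        intro inst m i r a
        obtain rfl : inst = instDecidableEqFin 3 := Subsingleton.elim _ _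
        fin_cases i <;> simp [hsmul1, hsmul2, hsmul3]
      map_eq_zero_of_eq' := by
        intro v i j hv hij
        have h3 : v 0 = v 1 ∨ v 1 = v 2 ∨ v 2 = v 0 := by
          fin_cases i <;> fin_cases j <;>
            first
            | exact absurd rfl hij
            | exact Or.inl hv
            | exact Or.inl hv.symm
            | exact Or.inr (Or.inl hv)
            | exact Or.inr (Or.inl hv.symm)
            | exact Or.inr (Or.inr hv)
            | exact Or.inr (Or.inr hv.symm)
        rcases h3 with h | h | h
        · rw [h, halt1]
        · rw [h, halt2]
        · rw [h, halt3] }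
  have hG : ∀ f g h : C^∞⟮𝓡 n, M; ℝ⟯,
      G ![differentialAt f x, differentialAt g x, differentialAt h x] = S f g h := fun f g h =>
    hcongr _ _ _ _ _ _ (hsD _) (hsD _) (hsD _)
  obtain ⟨T, hT, huniq⟩ := Multivector.existsUnique_wedgeEval_eq G
  refine ⟨T, fun f g h => ?_, fun T' hT' => huniq T' fun α => ?_⟩
  · simp only [hT, hG]; rfl
  · have hα : α = ![differentialAt (s (α 0)) x, differentialAt (s (α 1)) x,
        differentialAt (s (α 2)) x] := by
      ext i : 1
      fin_cases i <;> exact (hsD _).symm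
    rw [hα, hT', hG]

/-- The Schouten bracket `[p, q]` of two bivector fields, a field of trivectors. -/
noncomputable def schoutenBracket (p q : BivectorField n M) (x : M) :
    ⋀[ℝ]^3 (TangentSpace (𝓡 n) x) :=
  (existsUnique_schoutenBracket p q x).choose

theorem wedgeEval_schoutenBracket (p q : BivectorField n M) (x : M) (f g h : C^∞⟮𝓡 n, M; ℝ⟯) :
    Multivector.wedgeEval ![differentialAt f x, differentialAt g x, differentialAt h x]
      (schoutenBracket p q x) = schoutenDerivation p q f g h x :=
  (existsUnique_schoutenBracket p q x).choose_spec.1 f g h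

end BivectorField
end Manifold

/-!
Evaluated on differentials, the commutator of two hamiltonian fields satisfies
`[X_f, X_g] = X_{f, g} - 1/2 [p, p](df, dg, ·)`, where `X_{f, g}` is the hamiltonian field of
`{f, g}` and so takes its values in `π`. Hence `[X_f, X_g](x) ∈ π(x)` iff `[p, p](df, dg, γ)`
vanishes for every covector `γ` that annihilates `π(x)`; testing against the annihilator makes
jumps of the rank of `π` harmless. On the other hand a trivector lies in `⋀³ π(x)` iff its
evaluation vanishes as soon as one argument annihilates `π(x)`, and by skew symmetry this argument
can be taken to be the last.
-/

namespace Multivector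

theorem multilinearMap_eq_of_sub_mem {R ι N : Type*} {V : ι → Type*} [Finite ι]
    [CommRing R] [∀ i, AddCommGroup (V i)] [∀ i, Module R (V i)] [AddCommGroup N] [Module R N]
    (F : MultilinearMap R V N) (A : ∀ i, Submodule R (V i))
    (hF : ∀ m i, m i ∈ A i → F m = 0) {m m' : ∀ i, V i} (hm : ∀ i, m i - m' i ∈ A i) :
    F m = F m' := by
  obtain ⟨k, ⟨e⟩⟩ := Finite.exists_equiv_fin ι
  have := Fintype.ofFinite ι
  let _ : LinearOrder ι := LinearOrder.lift' e e.injective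
  have htelescope := F.map_piecewise_sub_map_piecewise m m' m Finset.univ
  simp only [Finset.piecewise_univ, Finset.mem_univ] at htelescope
  rw [← sub_eq_zero, htelescope]
  refine Finset.sum_eq_zero fun i _ => hF _ i ?_
  simpa using hm i

section
variable {V : Type*} [AddCommGroup V] [Module ℝ V] {k : ℕ}

theorem wedgeEval_map {W : Type*} [AddCommGroup W] [Module ℝ W] (F : V →ₗ[ℝ] W)
    (α : Fin k → Module.Dual ℝ W) (T : ⋀[ℝ]^k V) :
    wedgeEval α (exteriorPower.map k F T) = wedgeEval (fun i => α i ∘ₗ F) T := by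
  have h : (exteriorPower.pairingDual ℝ W k (exteriorPower.ιMulti ℝ k α)) ∘ₗ
      exteriorPower.map k F =
      exteriorPower.pairingDual ℝ V k (exteriorPower.ιMulti ℝ k fun i => α i ∘ₗ F) := by
    ext v
    simp
  exact LinearMap.congr_fun h T

/-- Evaluation at a fixed `k`-vector, as an alternating form on covectors. -/
noncomputable def wedgeForm (T : ⋀[ℝ]^k V) : (Module.Dual ℝ V) [⋀^Fin k]→ₗ[ℝ] ℝ :=
  ((exteriorPower.pairingDual ℝ V k).flip T).compAlternatingMap (exteriorPower.ιMulti ℝ k)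

theorem wedgeForm_apply (T : ⋀[ℝ]^k V) (α : Fin k → Module.Dual ℝ V) :
    wedgeForm T α = wedgeEval α T := rfl

theorem wedgeEval_eq_zero_of_mem_wedgePower {W : Submodule ℝ V} {T : ⋀[ℝ]^k V}
    (hT : T ∈ wedgePower k W) {α : Fin k → Module.Dual ℝ V} {i : Fin k}
    (hi : α i ∈ W.dualAnnihilator) : wedgeEval α T = 0 := by
  obtain ⟨S, rfl⟩ := hT
  rw [wedgeEval_map, ← wedgeForm_apply]
  refine AlternatingMap.map_coord_zero _ i ?_
  ext w
  exact (Submodule.mem_dualAnnihilator _).1 hi _ w.2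

theorem mem_wedgePower_of_wedgeEval_eq_zero [FiniteDimensional ℝ V] {W : Submodule ℝ V}
    {T : ⋀[ℝ]^k V} (hT : ∀ α i, α i ∈ W.dualAnnihilator → wedgeEval α T = 0) :
    T ∈ wedgePower k W := by
  obtain ⟨r, hr⟩ := W.subtype.exists_leftInverse_of_injective W.ker_subtype
  have hrestrict (α : Module.Dual ℝ V) : α - (α ∘ₗ W.subtype) ∘ₗ r ∈ W.dualAnnihilator := by
    refine (Submodule.mem_dualAnnihilator _).2 fun w hw => ?_
    have hrw : r w = ⟨w, hw⟩ := LinearMap.congr_fun hr ⟨w, hw⟩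
    simp [hrw]
  refine ⟨exteriorPower.map k r T,
    (existsUnique_wedgeEval_eq (wedgeForm T)).unique (fun α => ?_) fun α => rfl⟩
  rw [wedgeEval_map, wedgeEval_map]
  exact (multilinearMap_eq_of_sub_mem (wedgeForm T).toMultilinearMap
    (fun _ => W.dualAnnihilator) hT fun i => hrestrict (α i)).symm

theorem mem_wedgePower_iff [FiniteDimensional ℝ V] (i : Fin k) {W : Submodule ℝ V}
    {T : ⋀[ℝ]^k V} :
    T ∈ wedgePower k W ↔ ∀ α, α i ∈ W.dualAnnihilator → wedgeEval α T = 0 := by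
  refine ⟨fun hT _ => wedgeEval_eq_zero_of_mem_wedgePower hT, fun hT =>
    mem_wedgePower_of_wedgeEval_eq_zero fun α j hj => ?_⟩
  obtain rfl | hij := eq_or_ne i j
  · exact hT α hj
  · rw [← wedgeForm_apply, ← neg_eq_zero, ← (wedgeForm T).map_swap α hij]
    exact hT _ (by simpa using hj)

theorem mem_range_bivectorSharp_dualAnnihilator_iff {P : ⋀[ℝ]^2 V} [FiniteDimensional ℝ V]
    {γ : Module.Dual ℝ V} :
    γ ∈ (LinearMap.range (bivectorSharp P)).dualAnnihilator ↔ ∀ α, bivectorForm P α γ = 0 := by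
  simp [Submodule.mem_dualAnnihilator, apply_bivectorSharp, bivectorForm_apply]

end
end Multivector

section LieBracket
open Set VectorField
open scoped Topology
variable {𝕜 : Type*} [NontriviallyNormedField 𝕜] {E F : Type*} [NormedAddCommGroup E]
  [NormedSpace 𝕜 E] [NormedAddCommGroup F] [NormedSpace 𝕜 F]

theorem fderivWithin_lieBracketWithin {f : E → F} {V W : E → E} {s : Set E} {x : E}
    (hs : UniqueDiffWithinAt 𝕜 s x) (hf : DifferentiableWithinAt 𝕜 (fderivWithin 𝕜 f s) s x)
    (hsymm : IsSymmSndFDerivWithinAt 𝕜 f s x) (hV : DifferentiableWithinAt 𝕜 V s x)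
    (hW : DifferentiableWithinAt 𝕜 W s x) :
    fderivWithin 𝕜 f s x (lieBracketWithin 𝕜 V W s x) =
      fderivWithin 𝕜 (fun y => fderivWithin 𝕜 f s y (W y)) s x (V x) -
        fderivWithin 𝕜 (fun y => fderivWithin 𝕜 f s y (V y)) s x (W x) := by
  simp [fderivWithin_clm_apply hs hf hV, fderivWithin_clm_apply hs hf hW, lieBracketWithin,
    hsymm.eq (V x) (W x)]

variable {H : Type*} [TopologicalSpace H] {I : ModelWithCorners 𝕜 E H} {M : Type*}
  [TopologicalSpace M] [ChartedSpace H M]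

variable (I) in
/-- A vector field on a manifold, read in the extended chart at `x` as a map on the model space. -/
noncomputable def chartField (x : M) (V : ∀ y : M, TangentSpace I y) : E → E :=
  mpullbackWithin 𝓘(𝕜, E) I (extChartAt I x).symm V (range I)

section
variable [IsManifold I 1 M]

theorem chartField_extChartAt (V : ∀ y : M, TangentSpace I y) {x y : M}
    (hy : y ∈ (extChartAt I x).source) :
    chartField I x V (extChartAt I x y) = mfderiv I 𝓘(𝕜, E) (extChartAt I x) y (V y) := by
  have hyt := (extChartAt I x).map_source hy
  rw [chartField, mpullbackWithin_apply, ContinuousLinearMap.inverse_eq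
    (mfderivWithin_extChartAt_symm_comp_mfderiv_extChartAt hyt)
    (mfderiv_extChartAt_comp_mfderivWithin_extChartAt_symm hyt), (extChartAt I x).left_inv hy]

theorem chartField_mlieBracket (V W : ∀ y : M, TangentSpace I y) (x : M) :
    chartField I x (mlieBracket I V W) (extChartAt I x x) =
      lieBracketWithin 𝕜 (chartField I x V) (chartField I x W) (range I) (extChartAt I x x) := by
  have hinv := isInvertible_mfderiv_extChartAt (I := I) (mem_extChartAt_source x)
  rw [chartField_extChartAt _ (mem_extChartAt_source x), ← mlieBracketWithin_univ,
    mlieBracketWithin_apply, preimage_univ, univ_inter]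
  exact hinv.self_apply_inverse _

theorem fderivWithin_comp_extChartAt_symm_chartField {f : M → F} (V : ∀ y : M, TangentSpace I y)
    {x : M} {z : E} (hz : z ∈ (extChartAt I x).target)
    (hf : MDifferentiableAt I 𝓘(𝕜, F) f ((extChartAt I x).symm z)) :
    fderivWithin 𝕜 (f ∘ (extChartAt I x).symm) (range I) z (chartField I x V z) =
      mvfderiv I f ((extChartAt I x).symm z) (V ((extChartAt I x).symm z)) := by
  have hchain := mfderiv_comp_mfderivWithin z hf (mdifferentiableWithinAt_extChartAt_symm hz)
    (I.uniqueMDiffOn _ (extChartAt_target_subset_range x hz))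
  rw [mfderivWithin_eq_fderivWithin] at hchain
  have hinv := isInvertible_mfderivWithin_extChartAt_symm (I := I) hz
  rw [hchain]
  exact congrArg _ (hinv.self_apply_inverse _)

theorem mvfderiv_eq_fderivWithin_chartField {f : M → F} {x : M}
    (hf : MDifferentiableAt I 𝓘(𝕜, F) f x) (V : ∀ y : M, TangentSpace I y) :
    mvfderiv I f x (V x) = fderivWithin 𝕜 (f ∘ (extChartAt I x).symm) (range I)
      (extChartAt I x x) (chartField I x V (extChartAt I x x)) := by
  rw [← extChartAt_to_inv (I := I) x] at hf
  rw [fderivWithin_comp_extChartAt_symm_chartField V (mem_extChartAt_target x) hf,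
    extChartAt_to_inv]

end

theorem contDiffWithinAt_comp_extChartAt_symm {f : M → F} {x : M} {k : ℕ∞ω}
    (hf : CMDiffAt k f x) :
    ContDiffWithinAt 𝕜 k (f ∘ (extChartAt I x).symm) (range I) (extChartAt I x x) :=
  (contMDiffAt_iff.1 hf).2

theorem differentiableWithinAt_fderivWithin_comp_extChartAt_symm {f : M → F} {x : M}
    (hf : CMDiffAt 2 f x) :
    DifferentiableWithinAt 𝕜 (fderivWithin 𝕜 (f ∘ (extChartAt I x).symm) (range I)) (range I)
      (extChartAt I x x) :=
  ((contDiffWithinAt_comp_extChartAt_symm hf).fderivWithin_right I.uniqueDiffOn (m := 1) le_rfl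
    (mem_range_self _)).differentiableWithinAt one_ne_zero

section
variable [IsManifold I 2 M]

theorem mvfderiv_comp_extChartAt_symm_eventuallyEq {f : M → F} {x : M}
    (hf : CMDiffAt 2 f x) (V : ∀ y : M, TangentSpace I y) :
    (fun y => mvfderiv I f y (V y)) ∘ (extChartAt I x).symm =ᶠ[𝓝[range I] (extChartAt I x x)]
      fun z => fderivWithin 𝕜 (f ∘ (extChartAt I x).symm) (range I) z (chartField I x V z) := by
  have hfx : ∀ᶠ y in 𝓝 x, MDiffAt f y :=
    ((contMDiffAt_iff_contMDiffAt_nhds (by simp)).1 hf).mono fun y hy =>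
      hy.mdifferentiableAt two_ne_zero
  have hsymm : Filter.Tendsto (extChartAt I x).symm (𝓝[range I] (extChartAt I x x)) (𝓝 x) := by
    simpa using (continuousAt_extChartAt_symm (I := I) x).tendsto.mono_left nhdsWithin_le_nhds
  filter_upwards [hsymm.eventually hfx, extChartAt_target_mem_nhdsWithin (I := I) x] with z hz hzt
  exact (fderivWithin_comp_extChartAt_symm_chartField V hzt hz).symm

variable [CompleteSpace E]

theorem differentiableWithinAt_chartField {V : ∀ y : M, TangentSpace I y} {x : M}
    (hV : MDiffAt (T% V) x) :
    DifferentiableWithinAt 𝕜 (chartField I x V) (range I) (extChartAt I x x) := by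
  have h := hV.mdifferentiableWithinAt (s := univ)
  simpa only [chartField, preimage_univ, univ_inter] using
    h.differentiableWithinAt_mpullbackWithin_vectorField

theorem mdifferentiableAt_mvfderiv_apply {f : M → F} {V : ∀ y : M, TangentSpace I y} {x : M}
    (hf : CMDiffAt 2 f x) (hV : MDiffAt (T% V) x) :
    MDiffAt (fun y => mvfderiv I f y (V y)) x := by
  have hchart := (differentiableWithinAt_fderivWithin_comp_extChartAt_symm hf).clm_apply
    (differentiableWithinAt_chartField hV)
  rw [← mdifferentiableWithinAt_univ]
  refine DifferentiableWithinAt.mdifferentiableWithinAt_of_comp_extChartAt_symm ?_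
  rw [preimage_univ, univ_inter]
  exact hchart.congr_of_eventuallyEq_of_mem (mvfderiv_comp_extChartAt_symm_eventuallyEq hf V)
    (mem_range_self _)

theorem mvfderiv_mvfderiv_apply {f : M → F} {V : ∀ y : M, TangentSpace I y} {x : M}
    (hf : CMDiffAt 2 f x) (hV : MDiffAt (T% V) x) (W : ∀ y : M, TangentSpace I y) :
    mvfderiv I (fun y => mvfderiv I f y (V y)) x (W x) =
      fderivWithin 𝕜 (fun z => fderivWithin 𝕜 (f ∘ (extChartAt I x).symm) (range I) z
        (chartField I x V z)) (range I) (extChartAt I x x)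
          (chartField I x W (extChartAt I x x)) := by
  rw [mvfderiv_eq_fderivWithin_chartField (mdifferentiableAt_mvfderiv_apply hf hV),
    (mvfderiv_comp_extChartAt_symm_eventuallyEq hf V).fderivWithin_eq_of_mem (mem_range_self _)]

theorem mvfderiv_mlieBracket {f : M → F} {V W : ∀ y : M, TangentSpace I y} {x : M}
    (hf : CMDiffAt (minSmoothness 𝕜 2) f x) (hV : MDiffAt (T% V) x) (hW : MDiffAt (T% W) x) :
    mvfderiv I f x (mlieBracket I V W x) =
      mvfderiv I (fun y => mvfderiv I f y (W y)) x (V x) -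
        mvfderiv I (fun y => mvfderiv I f y (V y)) x (W x) := by
  have hf₂ := hf.of_le le_minSmoothness
  have hsymm : IsSymmSndFDerivWithinAt 𝕜 (f ∘ (extChartAt I x).symm) (range I)
      (extChartAt I x x) :=
    (contDiffWithinAt_comp_extChartAt_symm hf).isSymmSndFDerivWithinAt le_rfl I.uniqueDiffOn
      (I.range_subset_closure_interior (mem_range_self _)) (mem_range_self _)
  rw [mvfderiv_eq_fderivWithin_chartField (hf₂.mdifferentiableAt two_ne_zero),
    chartField_mlieBracket, mvfderiv_mvfderiv_apply hf₂ hW, mvfderiv_mvfderiv_apply hf₂ hV]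
  exact fderivWithin_lieBracketWithin (I.uniqueDiffOn _ (mem_range_self _))
    (differentiableWithinAt_fderivWithin_comp_extChartAt_symm hf₂) hsymm
    (differentiableWithinAt_chartField hV) (differentiableWithinAt_chartField hW)

end

end LieBracket

section
open VectorField
variable {𝕜 : Type*} [NontriviallyNormedField 𝕜] {E : Type*} [NormedAddCommGroup E]
  [NormedSpace 𝕜 E] [CompleteSpace E] {H : Type*} [TopologicalSpace H]
  {I : ModelWithCorners 𝕜 E H} {M : Type*} [TopologicalSpace M] [ChartedSpace H M]
  [IsManifold I 2 M]

theorem mlieBracket_sum_smul_mem_right {ι : Type*} {s : Finset ι} {x : M}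
    {D : Submodule 𝕜 (TangentSpace I x)} {φ : ι → M → 𝕜} {V : ∀ y : M, TangentSpace I y}
    {W : ι → ∀ y : M, TangentSpace I y} (hφ : ∀ i ∈ s, MDifferentiableAt I 𝓘(𝕜, 𝕜) (φ i) x)
    (hW : ∀ i ∈ s, MDiffAt (T% (W i)) x) (hWD : ∀ i ∈ s, W i x ∈ D)
    (hVW : ∀ i ∈ s, mlieBracket I V (W i) x ∈ D) :
    mlieBracket I V (fun y => ∑ i ∈ s, φ i y • W i y) x ∈ D := by
  induction s using Finset.cons_induction with
  | empty =>
    change mlieBracket I V 0 x ∈ D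
    simp
  | cons a s ha ih =>
    simp only [Finset.forall_mem_cons] at hφ hW hWD hVW
    have hsum : MDiffAt (T% (fun y => ∑ i ∈ s, φ i y • W i y)) x :=
      MDifferentiableAt.sum_section fun i hi => (hφ.2 i hi).smul_section (hW.2 i hi)
    simp only [Finset.sum_cons]
    change mlieBracket I V (φ a • W a + fun y => ∑ i ∈ s, φ i y • W i y) x ∈ D
    rw [mlieBracket_add_right (hφ.1.smul_section hW.1) hsum,
      mlieBracket_smul_right hφ.1 hW.1]
    exact D.add_mem (D.add_mem (D.smul_mem _ hWD.1) (D.smul_mem _ hVW.1))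
      (ih hφ.2 hW.2 hWD.2 hVW.2)

theorem mlieBracket_sum_smul_mem_left {ι : Type*} {s : Finset ι} {x : M}
    {D : Submodule 𝕜 (TangentSpace I x)} {φ : ι → M → 𝕜} {V : ι → ∀ y : M, TangentSpace I y}
    {W : ∀ y : M, TangentSpace I y} (hφ : ∀ i ∈ s, MDifferentiableAt I 𝓘(𝕜, 𝕜) (φ i) x)
    (hV : ∀ i ∈ s, MDiffAt (T% (V i)) x) (hVD : ∀ i ∈ s, V i x ∈ D)
    (hVW : ∀ i ∈ s, mlieBracket I (V i) W x ∈ D) :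
    mlieBracket I (fun y => ∑ i ∈ s, φ i y • V i y) W x ∈ D := by
  rw [mlieBracket_swap_apply, D.neg_mem_iff]
  refine mlieBracket_sum_smul_mem_right hφ hV hVD fun i hi => ?_
  rw [mlieBracket_swap_apply, D.neg_mem_iff]
  exact hVW i hi

end

section
variable {𝕜 : Type*} [NontriviallyNormedField 𝕜] [CompleteSpace 𝕜] {E : Type*}
  [NormedAddCommGroup E] [NormedSpace 𝕜 E] {H : Type*} [TopologicalSpace H]
  {I : ModelWithCorners 𝕜 E H} {M : Type*} [TopologicalSpace M] [ChartedSpace H M]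

theorem mdifferentiableAt_iff_forall_clm {F : Type*} [NormedAddCommGroup F] [NormedSpace 𝕜 F]
    [FiniteDimensional 𝕜 F] {f : M → F} {x : M} :
    MDifferentiableAt I 𝓘(𝕜, F) f x ↔
      ∀ l : F →L[𝕜] 𝕜, MDifferentiableAt I 𝓘(𝕜, 𝕜) (fun y => l (f y)) x := by
  refine ⟨fun hf l => l.mdifferentiableAt.comp x hf, fun hf => ?_⟩
  let b := Module.finBasis 𝕜 F
  have hcoord (i) :=
    (hf (b.coord i).toContinuousLinearMap).smul (mdifferentiableAt_const (c := b i))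
  convert MDifferentiableAt.sum (t := Finset.univ) fun i _ => hcoord i
  ext y : 1
  simp

end

section
variable {n : ℕ} {M : Type*} [TopologicalSpace M] [ChartedSpace (EuclideanSpace ℝ (Fin n)) M]
  [IsManifold (𝓡 n) ∞ M] [T2Space M]

theorem mdifferentiableAt_section_of_differentialAt {Z : ∀ y : M, TangentSpace (𝓡 n) y} {x : M}
    (hZ : ∀ u : C^∞⟮𝓡 n, M; ℝ⟯,
      MDifferentiableAt (𝓡 n) 𝓘(ℝ, ℝ) (fun y => differentialAt u y (Z y)) x) :
    MDifferentiableAt (𝓡 n) (𝓡 n).tangent (T% Z) x := by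
  obtain ⟨Φ, hΦ, hΦx⟩ := BivectorField.exists_globalChart (n := n) x
  rw [mdifferentiableAt_section, mdifferentiableAt_iff_forall_clm]
  intro l
  let u : C^∞⟮𝓡 n, M; ℝ⟯ := ⟨l ∘ Φ, l.contMDiff.comp hΦ⟩
  refine (hZ u).congr_of_eventuallyEq ?_
  have hsource := chart_source_mem_nhds (EuclideanSpace ℝ (Fin n)) x
  filter_upwards [hΦx.eventuallyEq_nhds, hsource] with y hy hyx
  rw [← Bundle.Trivialization.continuousLinearMapAt_apply_of_mem (R := ℝ) _ (by exact hyx),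
    TangentBundle.continuousLinearMapAt_trivializationAt hyx, ← hy.mfderiv_eq]
  exact (BivectorField.mvfderiv_eq_of_hasMFDerivAt (BivectorField.hasMFDerivAt_fderiv_comp
    ((hΦ y).mdifferentiableAt (by simp)) l.hasFDerivAt) _).symm

end

namespace BivectorField
open VectorField
variable {n : ℕ} {M : Type*} [TopologicalSpace M] [ChartedSpace (EuclideanSpace ℝ (Fin n)) M]

theorem hamiltonianField_mem_differentialSystem (p : BivectorField n M) (f : C^∞⟮𝓡 n, M; ℝ⟯)
    (x : M) : p.hamiltonianField f x ∈ p.differentialSystem x :=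
  LinearMap.mem_range_self _ _

theorem hamiltonianField_mem_spannedFields (p : BivectorField n M) (f : C^∞⟮𝓡 n, M; ℝ⟯) :
    p.hamiltonianField f ∈ p.spannedFields :=
  ⟨1, fun _ => 1, fun _ => f, by ext x; simp⟩

theorem bracket_eq_zero_of_mem_dualAnnihilator (p : BivectorField n M) {f g : C^∞⟮𝓡 n, M; ℝ⟯}
    {x : M} (hg : differentialAt g x ∈ (p.differentialSystem x).dualAnnihilator) :
    p.bracket f g x = 0 :=
  Multivector.mem_range_bivectorSharp_dualAnnihilator_iff.1 hg _

variable [IsManifold (𝓡 n) ∞ M] [T2Space M]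

theorem mdifferentiableAt_hamiltonianField (p : BivectorField n M) (f : C^∞⟮𝓡 n, M; ℝ⟯) (x : M) :
    MDifferentiableAt (𝓡 n) (𝓡 n).tangent (T% (p.hamiltonianField f)) x :=
  mdifferentiableAt_section_of_differentialAt fun u => by
    simpa only [differentialAt_hamiltonianField] using mdifferentiableAt_coe (p.bracket f u) x

theorem isInvolutive_iff_mlieBracket_hamiltonianField_mem (p : BivectorField n M) :
    p.IsInvolutive ↔ ∀ f g x, mlieBracket (𝓡 n) (p.hamiltonianField f) (p.hamiltonianField g) x ∈
      p.differentialSystem x := by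
  refine ⟨fun hp f g => hp _ (p.hamiltonianField_mem_spannedFields f) _
    (p.hamiltonianField_mem_spannedFields g), ?_⟩
  rintro hp _ ⟨k, φ, f, rfl⟩ _ ⟨l, ψ, g, rfl⟩ x
  have hmem (u) := p.hamiltonianField_mem_differentialSystem u x
  have hdiff (u) := p.mdifferentiableAt_hamiltonianField u x
  refine mlieBracket_sum_smul_mem_left (fun i _ => mdifferentiableAt_coe (φ i) x)
    (fun i _ => hdiff (f i)) (fun i _ => hmem (f i)) fun i _ => ?_
  exact mlieBracket_sum_smul_mem_right (fun j _ => mdifferentiableAt_coe (ψ j) x)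
    (fun j _ => hdiff (g j)) (fun j _ => hmem (g j)) fun j _ => hp (f i) (g j) x

theorem differentialAt_mlieBracket_hamiltonianField (p : BivectorField n M)
    (f g h : C^∞⟮𝓡 n, M; ℝ⟯) (x : M) :
    differentialAt h x (mlieBracket (𝓡 n) (p.hamiltonianField f) (p.hamiltonianField g) x) =
      p.bracket f (p.bracket g h) x - p.bracket g (p.bracket f h) x := by
  have hbracket (u : C^∞⟮𝓡 n, M; ℝ⟯) :
      (fun y => mvfderiv (𝓡 n) h y (p.hamiltonianField u y)) = p.bracket u h :=
    funext (p.differentialAt_hamiltonianField u h)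
  have hh : ContMDiffAt (𝓡 n) 𝓘(ℝ, ℝ) (minSmoothness ℝ 2) h x :=
    (h.contMDiff x).of_le (by simpa using ENat.LEInfty.out)
  rw [← differentialAt_hamiltonianField, ← differentialAt_hamiltonianField]
  refine (mvfderiv_mlieBracket hh (p.mdifferentiableAt_hamiltonianField f x)
    (p.mdifferentiableAt_hamiltonianField g x)).trans ?_
  rw [hbracket, hbracket]
  rfl

theorem differentialAt_mlieBracket_hamiltonianField_eq_schoutenBracket (p : BivectorField n M)
    (f g h : C^∞⟮𝓡 n, M; ℝ⟯) (x : M) :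
    differentialAt h x (mlieBracket (𝓡 n) (p.hamiltonianField f) (p.hamiltonianField g) x) =
      p.bracket (p.bracket f g) h x - 1 / 2 * Multivector.wedgeEval
        ![differentialAt f x, differentialAt g x, differentialAt h x] (schoutenBracket p p x) := by
  rw [differentialAt_mlieBracket_hamiltonianField, wedgeEval_schoutenBracket,
    p.bracket_swap f (p.bracket g h), p.bracket_swap g (p.bracket f h)]
  simp only [schoutenDerivation, compProd, ContMDiffMap.coe_add, ContMDiffMap.coe_sub,
    ContMDiffMap.coe_neg, Pi.add_apply, Pi.sub_apply, Pi.neg_apply]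
  ring

theorem mlieBracket_hamiltonianField_mem_differentialSystem_iff (p : BivectorField n M)
    {f g : C^∞⟮𝓡 n, M; ℝ⟯} {x : M} :
    mlieBracket (𝓡 n) (p.hamiltonianField f) (p.hamiltonianField g) x ∈ p.differentialSystem x ↔
      ∀ γ ∈ (p.differentialSystem x).dualAnnihilator, Multivector.wedgeEval
        ![differentialAt f x, differentialAt g x, γ] (schoutenBracket p p x) = 0 := by
  rw [← Subspace.forall_mem_dualAnnihilator_apply_eq_zero_iff]
  refine forall₂_congr fun γ hγ => ?_
  obtain ⟨h, rfl⟩ := differentialAt_surjective x γ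
  simp [differentialAt_mlieBracket_hamiltonianField_eq_schoutenBracket,
    p.bracket_eq_zero_of_mem_dualAnnihilator hγ]

theorem schoutenBracket_mem_wedgePower_iff (p : BivectorField n M) {x : M} :
    schoutenBracket p p x ∈ Multivector.wedgePower 3 (p.differentialSystem x) ↔
      ∀ f g, mlieBracket (𝓡 n) (p.hamiltonianField f) (p.hamiltonianField g) x ∈
        p.differentialSystem x := by
  simp only [Multivector.mem_wedgePower_iff 2,
    mlieBracket_hamiltonianField_mem_differentialSystem_iff]
  refine ⟨fun hT f g γ hγ => hT _ hγ, fun hT α hα => ?_⟩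
  obtain ⟨f, hf : differentialAt f x = α 0⟩ := differentialAt_surjective x (α 0)
  obtain ⟨g, hg : differentialAt g x = α 1⟩ := differentialAt_surjective x (α 1)
  have hα_cons : ![α 0, α 1, α 2] = α := FinVec.etaExpand_eq α
  rw [← hα_cons, ← hf, ← hg]
  exact hT f g (α 2) hα

end BivectorField

theorem mainTheorem5 {n : ℕ} {M : Type*} [TopologicalSpace M]
    [ChartedSpace (EuclideanSpace ℝ (Fin n)) M] [IsManifold (𝓡 n) ∞ M] [T2Space M]
    (p : BivectorField n M) :
    p.IsInvolutive ↔
      ∀ x : M, BivectorField.schoutenBracket p p x ∈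
        Multivector.wedgePower 3 (p.differentialSystem x) := by
  rw [p.isInvolutive_iff_mlieBracket_hamiltonianField_mem]
  simp only [p.schoutenBracket_mem_wedgePower_iff]
  exact ⟨fun h x f g => h f g x, fun h f g x => h x f g⟩
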